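/- Let $a_1,a_2,a_3\in\mathbb{C}$ be nonzero and let $c=(c_1,c_2)\in\mathbb{C}^2\setminus\{0\}$. An entire function on $\mathbb{C}^2$ is called transcendental if it is not a polynomial, and of finite order if $\limsup_{r\to\infty}\frac{\log^+\log^+ M(r,f)}{\log r}<\infty$, where $M(r,f)=\max_{|z|\le r}|f(z)|$. Let $(f_1,f_2)$ be a pair of transcendental entire functions on $\mathbb{C}^2$ of finite order such that, for all $z\in\mathbb{C}^2$, $$a_1^2f_1(z)^2+\bigl(a_2f_2(z+c)+a_3f_2(z)\bigr)^2=1,\qquad a_1^2f_2(z)^2+\bigl(a_2f_1(z+c)+a_3f_1(z)\bigr)^2=1 .$$ Then there are $\alpha_1,\alpha_2,A,k\in\mathbb{C}$ and a polynomial $\Phi$ in one variable with complex coefficients such that, with $L(z)=\alpha_1z_1+\alpha_2z_2$ and $t=c_2z_1-c_1z_2$, one of the following holds. I. $\displaystyle (f_1(z),f_2(z))=\left(\frac{1}{a_1}\cos\bigl(L(z)+\Phi(t)+A\bigr),\ \frac{1}{a_1}\cos\bigl(L(z)+\Phi(t)+A+k\bigr)\right)$, where $a_2^2=a_1^2+a_3^2$,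 $e^{2ik}=1$ and $\displaystyle e^{2iL(c)}=-\frac{a_1-ia_3e^{-ik}}{a_1+ia_3e^{ik}}$. II. $\displaystyle (f_1(z),f_2(z))=\left(\frac{1}{a_1}\cos\bigl(-(L(z)+\Phi(t)+A)+k\bigr),\ \frac{1}{a_1}\cos\bigl(L(z)+\Phi(t)+A\bigr)\right)$, where one of the following holds, with corresponding signs: (a) $e^{iL(c)}=1$, $e^{ik}=\pm i$ and $a_1=\pm(a_2+a_3)$; (b) $e^{iL(c)}=-1$, $e^{ik}=\pm i$ and $a_1=\mp(a_2-a_3)$. III. $\displaystyle (f_1(z),f_2(z))=\left(\frac{1}{a_1}\cos\bigl(-(L(z)+\Phi(t)+A)+L(c)+k\bigr),\ \frac{1}{a_1}\cos\bigl(L(z)+\Phi(t)+A\bigr)\right)$, where one of the following holds, with corresponding signs: (a) $e^{iL(c)}=1$, $e^{ik}=\pm i$ and $a_1=\pm(a_2+a_3)$; (b) $e^{iL(c)}=-1$, $e^{ik}=\pm i$ and $a_1=\pm(a_2-a_3)$. -/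

import Mathlib

open Complex Filter

noncomputable section

/-- `f` is a transcendental entire function on `ℂ²`: it is holomorphic on all of `ℂ²` and it is not
a polynomial in `(z₁, z₂)`. -/
def IsTranscendentalEntire (f : ℂ × ℂ → ℂ) : Prop :=
  Differentiable ℂ f ∧
    ¬ ∃ P : MvPolynomial (Fin 2) ℂ, ∀ z : ℂ × ℂ, f z = MvPolynomial.eval ![z.1, z.2] P

/-- The maximum modulus `M(r, f)` of `f` over the closed Euclidean ball of radius `r` around the
origin of `ℂ²`. -/
def maxModulus (f : ℂ × ℂ → ℂ) (r : ℝ) : ℝ :=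
  sSup ((fun z : ℂ × ℂ => ‖f z‖) '' {z : ℂ × ℂ | ‖z.1‖ ^ 2 + ‖z.2‖ ^ 2 ≤ r ^ 2})

/-- The order of growth `limsup_{r → ∞} log⁺ log⁺ M(r, f) / log r` of an entire function on `ℂ²`,
as an extended real number. -/
def growthOrder (f : ℂ × ℂ → ℂ) : EReal :=
  limsup (fun r : ℝ =>
    ((Real.posLog (Real.posLog (maxModulus f r)) / Real.log r : ℝ) : EReal)) atTop

/-- `f` has finite order of growth. -/
def HasFiniteOrder (f : ℂ × ℂ → ℂ) : Prop := growthOrder f < ⊤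

/-- `(f₁, f₂)` solves the Fermat-type system
`a₁² f₁(z)² + (a₂ f₂(z+c) + a₃ f₂(z))² = 1`, `a₁² f₂(z)² + (a₂ f₁(z+c) + a₃ f₁(z))² = 1`
on `ℂ²`. -/
def IsFermatSolution (a₁ a₂ a₃ : ℂ) (c : ℂ × ℂ) (f₁ f₂ : ℂ × ℂ → ℂ) : Prop :=
  ∀ z : ℂ × ℂ,
    a₁ ^ 2 * f₁ z ^ 2 + (a₂ * f₂ (z + c) + a₃ * f₂ z) ^ 2 = 1 ∧
    a₁ ^ 2 * f₂ z ^ 2 + (a₂ * f₁ (z + c) + a₃ * f₁ z) ^ 2 = 1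

/-- The linear form `L(z) = α₁ z₁ + α₂ z₂`. -/
def linForm (α₁ α₂ : ℂ) (z : ℂ × ℂ) : ℂ := α₁ * z.1 + α₂ * z.2

/-- The phase `L(z) + Φ(t) + A` with `L(z) = α₁ z₁ + α₂ z₂` and `t = c₂ z₁ - c₁ z₂`. -/
def phase (c : ℂ × ℂ) (α₁ α₂ : ℂ) (Φ : Polynomial ℂ) (A : ℂ) (z : ℂ × ℂ) : ℂ :=
  linForm α₁ α₂ z + Φ.eval (c.2 * z.1 - c.1 * z.2) + A

end

/-! Each equation has the form F² + G² = 1, that is (F + iG)(F - iG) = 1, so F + iG is zero-free of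
finite order and equals the exponential of a polynomial. Hence a₁f₁ = cos p and a₁f₂ = cos q, where
a₂ cos q(z+c) + a₃ cos q = a₁ sin p and the same holds with p and q exchanged.

Written in exponentials, each identity has six terms. Borel's theorem
(`Polynomial.eq_zero_of_sum_mul_exp_add_eq_zero`) forces p, q and q(·+c) to agree up to sign and
additive constants. A periodicity argument removes the sign between q and q(·+c), so p and q each
change by a constant under translation by c. Such a function is a linear form plus a polynomial in
t. If q = p + k, comparing coefficients of exp(±ip) gives form I; if q = -p + k, it gives form II.
Form III is form II with k replaced by L(c) + k.

Polynomials in two variables are never needed: it is enough that p and q are polynomial on every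
complex line. -/

/-! ### Growth of functions of finite order -/

/-- `log⁺ ‖f‖` grows at most polynomially. -/
def ExpPolyGrowth {E : Type*} [NormedAddCommGroup E] (f : E → ℂ) : Prop :=
  ∃ (C : ℝ) (N : ℕ), ∀ z, Real.posLog ‖f z‖ ≤ C * (1 + ‖z‖) ^ N

namespace ExpPolyGrowth

variable {E : Type*} [NormedAddCommGroup E] {f g : E → ℂ}

theorem add (hf : ExpPolyGrowth f) (hg : ExpPolyGrowth g) :
    ExpPolyGrowth (fun z => f z + g z) := by
  obtain ⟨C, N, h⟩ := hf
  obtain ⟨D, M, k⟩ := hg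
  have hC : 0 ≤ C := by simpa using Real.posLog_nonneg.trans (h 0)
  have hD : 0 ≤ D := by simpa using Real.posLog_nonneg.trans (k 0)
  refine ⟨Real.log 2 + C + D, N + M, fun z => ?_⟩
  have hz : 1 ≤ 1 + ‖z‖ := by linarith [norm_nonneg z]
  have h1 : (1 + ‖z‖) ^ N ≤ (1 + ‖z‖) ^ (N + M) := pow_le_pow_right₀ hz (by omega)
  have h2 : (1 + ‖z‖) ^ M ≤ (1 + ‖z‖) ^ (N + M) := pow_le_pow_right₀ hz (by omega)
  have h3 : 1 ≤ (1 + ‖z‖) ^ (N + M) := one_le_pow₀ hz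
  have h4 : 0 ≤ Real.log 2 := Real.log_nonneg (by norm_num)
  calc Real.posLog ‖f z + g z‖ ≤ Real.log 2 + Real.posLog ‖f z‖ + Real.posLog ‖g z‖ :=
        (Real.posLog_norm_add_le _ _).trans (by linarith)
    _ ≤ Real.log 2 + C * (1 + ‖z‖) ^ N + D * (1 + ‖z‖) ^ M := by gcongr <;> simp [h, k]
    _ ≤ Real.log 2 * (1 + ‖z‖) ^ (N + M) + C * (1 + ‖z‖) ^ (N + M)
          + D * (1 + ‖z‖) ^ (N + M) := by
        gcongr
        exact le_mul_of_one_le_right h4 h3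
    _ = _ := by ring

theorem const_mul (a : ℂ) (hf : ExpPolyGrowth f) : ExpPolyGrowth (fun z => a * f z) := by
  obtain ⟨C, N, h⟩ := hf
  refine ⟨Real.posLog ‖a‖ + C, N, fun z => ?_⟩
  have h3 : 1 ≤ (1 + ‖z‖) ^ N := one_le_pow₀ (by linarith [norm_nonneg z])
  calc Real.posLog ‖a * f z‖ ≤ Real.posLog ‖a‖ + Real.posLog ‖f z‖ := by
        rw [norm_mul]; exact Real.posLog_mul
    _ ≤ Real.posLog ‖a‖ * (1 + ‖z‖) ^ N + C * (1 + ‖z‖) ^ N :=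
        add_le_add (le_mul_of_one_le_right Real.posLog_nonneg h3) (h z)
    _ = _ := by ring

theorem comp_of_norm_le {E' : Type*} [NormedAddCommGroup E'] (hf : ExpPolyGrowth f)
    {φ : E' → E} {D : ℝ} (hφ : ∀ w, 1 + ‖φ w‖ ≤ D * (1 + ‖w‖)) :
    ExpPolyGrowth (fun w => f (φ w)) := by
  obtain ⟨C, N, h⟩ := hf
  have hC : 0 ≤ C := by simpa using Real.posLog_nonneg.trans (h 0)
  refine ⟨C * D ^ N, N, fun w => (h _).trans ?_⟩
  rw [mul_assoc, ← mul_pow]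
  gcongr
  exact hφ w

theorem comp_add_const (hf : ExpPolyGrowth f) (c : E) : ExpPolyGrowth (fun z => f (z + c)) := by
  refine hf.comp_of_norm_le (D := 1 + ‖c‖) fun w => ?_
  nlinarith [norm_add_le w c, norm_nonneg w, norm_nonneg c]

theorem comp_line [NormedSpace ℂ E] (hf : ExpPolyGrowth f) (a b : E) :
    ExpPolyGrowth (fun s : ℂ => f (a + s • b)) := by
  refine hf.comp_of_norm_le (D := 1 + ‖a‖ + ‖b‖) fun s => ?_
  have := norm_add_le a (s • b)
  rw [norm_smul] at this
  nlinarith [mul_nonneg (norm_nonneg s) (norm_nonneg a), norm_nonneg s, norm_nonneg b]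

end ExpPolyGrowth

theorem norm_le_maxModulus {f : ℂ × ℂ → ℂ} (hf : Continuous f) {r : ℝ} {z : ℂ × ℂ}
    (hz : ‖z.1‖ ^ 2 + ‖z.2‖ ^ 2 ≤ r ^ 2) : ‖f z‖ ≤ maxModulus f r := by
  refine le_csSup ?_ ⟨z, hz, rfl⟩
  have hK : IsCompact {z : ℂ × ℂ | ‖z.1‖ ^ 2 + ‖z.2‖ ^ 2 ≤ r ^ 2} := by
    refine Metric.isCompact_of_isClosed_isBounded
      (isClosed_le (by fun_prop) continuous_const) ?_
    refine (Metric.isBounded_closedBall (x := (0 : ℂ × ℂ)) (r := |r|)).subset fun w hw => ?_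
    simp only [Set.mem_ofPred_eq] at hw
    rw [mem_closedBall_zero_iff, Prod.norm_def, max_le_iff]
    constructor
    · simpa using sq_le_sq.mp (le_trans (le_add_of_nonneg_right (sq_nonneg ‖w.2‖)) hw)
    · simpa using sq_le_sq.mp (le_trans (le_add_of_nonneg_left (sq_nonneg ‖w.1‖)) hw)
  exact (hK.image (by fun_prop)).bddAbove

theorem HasFiniteOrder.expPolyGrowth {f : ℂ × ℂ → ℂ} (hf : Continuous f)
    (ho : HasFiniteOrder f) : ExpPolyGrowth f := by
  obtain ⟨K, hK, -⟩ := EReal.lt_iff_exists_real_btwn.mp ho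
  obtain ⟨N, hN⟩ := exists_nat_ge K
  obtain ⟨R, hR⟩ := eventually_atTop.mp (eventually_lt_of_limsup_lt hK)
  set R' := max R 2
  have hR2 : 2 ≤ R' := le_max_right _ _
  refine ⟨(R' + 2) ^ N, N, fun z => ?_⟩
  -- `R'` puts every radius beyond the limsup threshold; the factor 2 fits a point of sup norm ‖z‖
  -- into the Euclidean ball of radius r.
  set r := R' + 2 * (1 + ‖z‖) with hr
  have hz := norm_nonneg z
  have hr1 : 1 < r := by linarith
  have h1 := hR r (by linarith [le_max_left R 2])
  rw [EReal.coe_lt_coe_iff, div_lt_iff₀ (Real.log_pos hr1)] at h1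
  have h2 : ‖f z‖ ≤ maxModulus f r := by
    refine norm_le_maxModulus hf ?_
    have e1 := norm_fst_le z
    have e2 := norm_snd_le z
    nlinarith [norm_nonneg z.1, norm_nonneg z.2]
  calc Real.posLog ‖f z‖ ≤ Real.posLog (maxModulus f r) :=
        Real.posLog_le_posLog (norm_nonneg _) h2
    _ ≤ r ^ N := by
        rcases (Real.posLog_nonneg (x := maxModulus f r)).eq_or_lt with h0 | h0
        · rw [← h0]; positivity
        · rw [← Real.log_le_log_iff h0 (by positivity), Real.log_pow]
          have : Real.log (Real.posLog (maxModulus f r)) ≤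
            Real.posLog (Real.posLog (maxModulus f r)) := le_max_right _ _
          nlinarith [Real.log_pos hr1]
    _ ≤ ((R' + 2) * (1 + ‖z‖)) ^ N := by
        gcongr
        nlinarith
    _ = _ := mul_pow _ _ _

/-! ### Polynomial logarithms of zero-free functions -/

/-- Cauchy's estimates on large circles kill every Taylor coefficient of index above N. -/
theorem exists_polynomial_of_norm_le {g : ℂ → ℂ} (hg : Differentiable ℂ g) {C : ℝ} {N : ℕ}
    (h : ∀ s, ‖g s‖ ≤ C * (1 + ‖s‖) ^ N) : ∃ P : Polynomial ℂ, ∀ s, g s = P.eval s := by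
  have hC : 0 ≤ C := by simpa using (norm_nonneg _).trans (h 0)
  have hzero : ∀ n, N < n → iteratedDeriv n g 0 = 0 := by
    intro n hn
    rw [← norm_le_zero_iff]
    have hbd : ∀ R : ℝ, 1 ≤ R → ‖iteratedDeriv n g 0‖ ≤ n.factorial * (C * 2 ^ N) * R⁻¹ := by
      intro R hR
      have hR0 : 0 < R := by linarith
      refine (norm_iteratedDeriv_le_of_forall_mem_sphere_norm_le n hR0 hg.diffContOnCl
        (C := C * (2 * R) ^ N) fun z hz => (h z).trans ?_).trans ?_
      · rw [mem_sphere_zero_iff_norm] at hz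
        rw [hz]; gcongr; linarith
      · rw [div_le_iff₀ (by positivity), mul_pow]
        have : R ^ N ≤ R⁻¹ * R ^ n := by
          rw [le_inv_mul_iff₀ hR0, ← pow_succ']
          exact pow_le_pow_right₀ hR hn
        calc (n.factorial : ℝ) * (C * (2 ^ N * R ^ N)) = n.factorial * (C * 2 ^ N) * R ^ N := by ring
          _ ≤ n.factorial * (C * 2 ^ N) * (R⁻¹ * R ^ n) := by gcongr
          _ = _ := by ring
    have ht : Tendsto (fun R : ℝ => n.factorial * (C * 2 ^ N) * R⁻¹) atTop (nhds 0) := by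
      simpa using tendsto_inv_atTop_zero.const_mul (n.factorial * (C * 2 ^ N) : ℝ)
    exact ge_of_tendsto ht ((eventually_ge_atTop 1).mono hbd)
  refine ⟨∑ n ∈ Finset.range (N + 1),
    Polynomial.C ((n.factorial : ℂ)⁻¹ * iteratedDeriv n g 0) * Polynomial.X ^ n, fun s => ?_⟩
  rw [← taylorSeries_eq_of_entire' (c := 0) s hg, Polynomial.eval_finsetSum,
    tsum_eq_sum (s := Finset.range (N + 1))]
  · simp
  · intro n hn
    rw [hzero n (by simpa using hn)]; simp

/-- The growth of exp g bounds Re g from above, and Borel–Carathéodory on a disc of radius 2(1 +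
|s|) turns this into a bound on |g|. -/
theorem exists_polynomial_of_expPolyGrowth_exp {g : ℂ → ℂ} (hg : Differentiable ℂ g)
    (h : ExpPolyGrowth (fun s => exp (g s))) : ∃ P : Polynomial ℂ, ∀ s, g s = P.eval s := by
  obtain ⟨C, N, h⟩ := h
  have hC : 0 ≤ C := by simpa using Real.posLog_nonneg.trans (h 0)
  have hre : ∀ s, (g s).re ≤ C * (1 + ‖s‖) ^ N := fun s => by
    refine le_trans ?_ (h s)
    rw [norm_exp]
    exact (Real.log_exp _).symm.le.trans (le_max_right _ _)
  refine exists_polynomial_of_norm_le hg (C := 2 * ((C + 1) * 3 ^ N) + ‖g 0‖ * 3) (N := N)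
    fun s => ?_
  set R := 2 * (1 + ‖s‖) with hR
  have hs := norm_nonneg s
  -- On the disc 1 + |w| ≤ 3(1 + |s|); `C + 1` makes M strictly positive.
  set M := (C + 1) * (3 * (1 + ‖s‖)) ^ N with hM
  have hM0 : 0 < M := by positivity
  have hb := borelCaratheodory (M := M) (R := R) (z := s) hM0 hg.differentiableOn
    (fun w hw => by
      have hw' : ‖w‖ < R := by simpa using hw
      refine (hre w).trans ?_
      have : 1 + ‖w‖ ≤ 3 * (1 + ‖s‖) := by linarith
      rw [hM]; gcongr; linarith) (by positivity) (by simp; linarith)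
  have h1 : 1 ≤ (1 + ‖s‖) ^ N := one_le_pow₀ (by linarith)
  have hd : 0 < R - ‖s‖ := by linarith
  calc ‖g s‖ ≤ _ := hb
    _ ≤ 2 * M + ‖g 0‖ * 3 := by
        gcongr
        · rw [div_le_iff₀ hd]; gcongr; linarith
        · rw [div_le_iff₀ hd, mul_assoc]; gcongr; linarith
    _ ≤ 2 * M + ‖g 0‖ * 3 * (1 + ‖s‖) ^ N := by
        rw [add_le_add_iff_left]
        exact le_mul_of_one_le_right (by positivity) h1
    _ = _ := by rw [hM, mul_pow]; ring

/-- By continuity, g(w) - g(s) stays in the strip of the principal logarithm for w near s. -/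
theorem differentiable_of_continuous_of_exp {g : ℂ → ℂ} (hg : Continuous g)
    (h : Differentiable ℂ (fun s => exp (g s))) : Differentiable ℂ g := by
  intro s
  have hev : ∀ᶠ w in nhds s, g w = g s + log (exp (g w) / exp (g s)) := by
    have ht : Tendsto (fun w => (g w - g s).im) (nhds s) (nhds 0) := by
      have : Continuous fun w => (g w - g s).im := by fun_prop
      simpa using this.tendsto s
    filter_upwards [ht.eventually (Ioo_mem_nhds (neg_lt_zero.mpr Real.pi_pos) Real.pi_pos)]
      with w hw
    rw [← exp_sub, log_exp hw.1 hw.2.le]; ring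
  refine DifferentiableAt.congr_of_eventuallyEq ?_ hev
  refine ((((h s).div_const _).clog ?_)).const_add _
  rw [div_self (exp_ne_zero _)]
  exact one_mem_slitPlane

/-- Every restriction of `p` to a complex line is a polynomial. -/
def IsPolyOnLines (p : ℂ × ℂ → ℂ) : Prop :=
  ∀ a b : ℂ × ℂ, ∃ P : Polynomial ℂ, ∀ s : ℂ, p (a + s • b) = P.eval s

theorem exists_isPolyOnLines_exp_eq {h : ℂ × ℂ → ℂ} (hd : Differentiable ℂ h)
    (h0 : ∀ z, h z ≠ 0) (hgr : ExpPolyGrowth h) :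
    ∃ p, IsPolyOnLines p ∧ ∀ z, exp (p z) = h z := by
  have hU : IsSimplyConnected (Set.univ : Set (ℂ × ℂ)) :=
    (Homeomorph.Set.univ (ℂ × ℂ)).toHomotopyEquiv.simplyConnectedSpace
  obtain ⟨p, hp, he⟩ := exists_continuousOn_eqOn_exp_comp hU isOpen_univ
    hd.continuous.continuousOn (by rintro ⟨z, -, hz⟩; exact h0 z hz)
  rw [continuousOn_univ] at hp
  have he' : ∀ z, exp (p z) = h z := fun z => he (Set.mem_univ z)
  refine ⟨p, fun a b => ?_, he'⟩
  refine exists_polynomial_of_expPolyGrowth_exp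
    (differentiable_of_continuous_of_exp (by fun_prop) ?_) ?_
  · simp only [he']; fun_prop
  · simp only [he']; exact hgr.comp_line a b

/-! ### Borel's theorem -/

/-- Borel's theorem on linear independence of exponentials of polynomials: an exponential whose
exponent differs from all the others by a nonconstant polynomial has zero coefficient in every
vanishing linear combination with polynomial coefficients. -/
theorem Polynomial.eq_zero_of_sum_mul_exp_add_eq_zero {ι : Type*} (s : Finset ι)
    (P g : ι → Polynomial ℂ) (Q h : Polynomial ℂ)
    (hne : ∀ i ∈ s, derivative (g i - h) ≠ 0)
    (H : ∀ x, ∑ i ∈ s, (P i).eval x * exp ((g i).eval x) + Q.eval x * exp (h.eval x) = 0) :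
    Q = 0 := by
  classical
  induction s using Finset.induction_on generalizing P Q with
  | empty =>
    refine Polynomial.funext fun x => ?_
    simpa using H x
  | insert j s hj ih =>
    have hs : ∀ i ∈ s, derivative (g i - h) ≠ 0 := fun i hi => hne i (Finset.mem_insert_of_mem hi)
    by_cases hP : P j = 0
    · refine ih P Q hs fun x => ?_
      simpa [Finset.sum_insert hj, hP] using H x
    have hder : ∀ (A u : Polynomial ℂ) (x : ℂ),
        HasDerivAt (fun x => A.eval x * exp (u.eval x))
          ((derivative A + A * derivative u).eval x * exp (u.eval x)) x := by
      intro A u x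
      refine ((A.hasDerivAt x).fun_mul (u.hasDerivAt x).cexp).congr_deriv ?_
      simp only [eval_add, eval_mul]; ring
    have H' : ∀ x, ∑ i ∈ insert j s, (derivative (P i) + P i * derivative (g i)).eval x *
        exp ((g i).eval x) + (derivative Q + Q * derivative h).eval x * exp (h.eval x) = 0 := by
      intro x
      have h1 := (HasDerivAt.fun_sum (u := insert j s) fun i _ => hder (P i) (g i) x).add
        (hder Q h x)
      refine h1.unique ?_
      have : ((fun x => ∑ i ∈ insert j s, (P i).eval x * exp ((g i).eval x)) +
          fun x => Q.eval x * exp (h.eval x)) = fun _ => 0 := by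
        funext x; exact H x
      rw [this]
      exact hasDerivAt_const x 0
    -- P_j times the differentiated relation, minus (P_j' + P_j g_j') times the original, has no
    -- exp(g_j) term.
    have key := ih
      (fun i => P j * (derivative (P i) + P i * derivative (g i)) -
        (derivative (P j) + P j * derivative (g j)) * P i)
      (P j * (derivative Q + Q * derivative h) -
        (derivative (P j) + P j * derivative (g j)) * Q) hs (fun x => by
        have e1 := H x
        have e2 := H' x
        rw [Finset.sum_insert hj] at e1 e2
        have e3 : ∑ i ∈ s, (P j * (derivative (P i) + P i * derivative (g i)) -
            (derivative (P j) + P j * derivative (g j)) * P i).eval x * exp ((g i).eval x) =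
            (P j).eval x * ∑ i ∈ s, (derivative (P i) + P i * derivative (g i)).eval x *
              exp ((g i).eval x) - (derivative (P j) + P j * derivative (g j)).eval x *
              ∑ i ∈ s, (P i).eval x * exp ((g i).eval x) := by
          rw [Finset.mul_sum, Finset.mul_sum, ← Finset.sum_sub_distrib]
          refine Finset.sum_congr rfl fun i _ => ?_
          simp only [eval_sub, eval_mul]; ring
        rw [e3]
        simp only [eval_sub, eval_mul] at e1 e2 ⊢
        linear_combination (P j).eval x * e2 -
          (derivative (P j) + P j * derivative (g j)).eval x * e1)
    by_contra hQ
    have hPQ : P j * Q ≠ 0 := mul_ne_zero hP hQ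
    -- The left side has degree at least that of P_j Q, the right side strictly less.
    have heq : P j * Q * derivative (g j - h) = P j * derivative Q - derivative (P j) * Q := by
      rw [derivative_sub]; linear_combination -key
    have h1 : (P j * Q).degree ≤ (P j * Q * derivative (g j - h)).degree :=
      degree_le_mul_left _ (hne j (Finset.mem_insert_self _ _))
    have h2 : (P j * derivative Q).degree < (P j * Q).degree := by
      rw [degree_mul, degree_mul]
      exact WithBot.add_lt_add_left (by simpa using hP) (degree_derivative_lt hQ)
    have h3 : (derivative (P j) * Q).degree < (P j * Q).degree := by
      rw [degree_mul, degree_mul]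
      exact WithBot.add_lt_add_right (by simpa using hQ) (degree_derivative_lt hP)
    rw [heq] at h1
    exact absurd h1 (not_le.mpr ((degree_sub_le _ _).trans_lt (max_lt h2 h3)))

/-! ### Functions polynomial on every line -/

namespace IsPolyOnLines

variable {f g p : ℂ × ℂ → ℂ}

theorem add (hf : IsPolyOnLines f) (hg : IsPolyOnLines g) :
    IsPolyOnLines (fun z => f z + g z) := fun a b => by
  obtain ⟨P, hP⟩ := hf a b
  obtain ⟨Q, hQ⟩ := hg a b
  exact ⟨P + Q, fun s => by simp [hP, hQ]⟩

theorem const_mul (k : ℂ) (hf : IsPolyOnLines f) : IsPolyOnLines (fun z => k * f z) :=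
  fun a b => by
    obtain ⟨P, hP⟩ := hf a b
    exact ⟨Polynomial.C k * P, fun s => by simp [hP]⟩

theorem neg (hf : IsPolyOnLines f) : IsPolyOnLines (fun z => -f z) := by
  simpa using hf.const_mul (-1)

theorem sub (hf : IsPolyOnLines f) (hg : IsPolyOnLines g) :
    IsPolyOnLines (fun z => f z - g z) := by
  simpa [sub_eq_add_neg] using hf.add hg.neg

theorem comp_add_const (hf : IsPolyOnLines f) (c : ℂ × ℂ) : IsPolyOnLines (fun z => f (z + c)) :=
  fun a b => by
    obtain ⟨P, hP⟩ := hf (a + c) b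
    exact ⟨P, fun s => by rw [← hP, add_right_comm]⟩

theorem linForm (α₁ α₂ : ℂ) : IsPolyOnLines (linForm α₁ α₂) := fun a b =>
  ⟨Polynomial.C (_root_.linForm α₁ α₂ a) + Polynomial.C (_root_.linForm α₁ α₂ b) * Polynomial.X,
    fun s => by simp [_root_.linForm]; ring⟩

/-- Along direction c the polynomial takes one value at all natural numbers, so it is constant. -/
theorem apply_add_smul_of_periodic (hf : IsPolyOnLines f) {c : ℂ × ℂ}
    (hc : ∀ z, f (z + c) = f z) (z : ℂ × ℂ) (s : ℂ) : f (z + s • c) = f z := by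
  obtain ⟨P, hP⟩ := hf z c
  have hn : ∀ n : ℕ, P.eval (n : ℂ) = f z := by
    intro n
    induction n with
    | zero => rw [← hP]; simp
    | succ n ih => rw [← ih, ← hP, ← hP, ← hc (z + (n : ℂ) • c), Nat.cast_succ, add_smul, one_smul,
        add_assoc]
  have : P = Polynomial.C (f z) := by
    refine Polynomial.eq_of_infinite_eval_eq _ _
      ((Set.infinite_range_of_injective (Nat.cast_injective (R := ℂ))).mono ?_)
    rintro _ ⟨n, rfl⟩
    simp [hn]
  rw [hP, this, Polynomial.eval_C]

theorem surjective_of_ne (hf : IsPolyOnLines f) {x y : ℂ × ℂ} (hxy : f x ≠ f y) :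
    Function.Surjective f := fun v => by
  obtain ⟨P, hP⟩ := hf x (y - x)
  have hdeg : (P - Polynomial.C v).degree ≠ 0 := fun h => by
    have e : ∀ s, P.eval s = v + (P - Polynomial.C v).coeff 0 := fun s => by
      have := congrArg (Polynomial.eval s) (Polynomial.eq_C_of_degree_eq_zero h)
      rw [Polynomial.eval_sub, Polynomial.eval_C, Polynomial.eval_C] at this
      linear_combination this
    apply hxy
    have h0 := hP 0
    have h1 := hP 1
    rw [e] at h0 h1
    simp only [zero_smul, one_smul, add_zero, add_sub_cancel] at h0 h1
    rw [h0, h1]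
  obtain ⟨s, hs⟩ := IsAlgClosed.exists_root _ hdeg
  refine ⟨x + s • (y - x), ?_⟩
  rw [hP]
  simpa [sub_eq_zero] using hs

/-- On the line joining a point good for the earlier indices to one good for the new index, each
condition excludes only finitely many parameters. -/
theorem exists_forall_ne {ι : Type*} (s : Finset ι) (d : ι → ℂ × ℂ → ℂ)
    (hd : ∀ i ∈ s, IsPolyOnLines (d i)) (x : ℂ × ℂ) (hne : ∀ i ∈ s, ∃ z, d i z ≠ d i x) :
    ∃ z, ∀ i ∈ s, d i z ≠ d i x := by
  classical
  induction s using Finset.induction_on with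
  | empty => exact ⟨0, by simp⟩
  | insert j s hj ih =>
    obtain ⟨u, hu⟩ := ih (fun i hi => hd i (Finset.mem_insert_of_mem hi))
      (fun i hi => hne i (Finset.mem_insert_of_mem hi))
    obtain ⟨v, hv⟩ := hne j (Finset.mem_insert_self _ _)
    have hfin : ∀ i ∈ insert j s, {t : ℂ | d i (u + t • (v - u)) = d i x}.Finite := by
      intro i hi
      obtain ⟨P, hP⟩ := hd i hi u (v - u)
      have hP0 : P - Polynomial.C (d i x) ≠ 0 := fun h0 => by
        have e : ∀ t, d i (u + t • (v - u)) = d i x := fun t => by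
          rw [hP, sub_eq_zero.mp h0, Polynomial.eval_C]
        rcases Finset.mem_insert.mp hi with rfl | hi'
        · exact hv (by simpa using e 1)
        · exact hu i hi' (by simpa using e 0)
      refine (Polynomial.finite_setOfPred_isRoot hP0).subset fun t ht => ?_
      simpa [Polynomial.IsRoot, ← hP, sub_eq_zero] using ht
    obtain ⟨t, ht⟩ := ((insert j s).finite_toSet.biUnion hfin).infinite_compl.nonempty
    refine ⟨u + t • (v - u), fun i hi h => ht ?_⟩
    exact Set.mem_biUnion (Finset.mem_coe.mpr hi) h

/-- Borel's theorem along a generic line through the origin. -/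
theorem exists_sub_eq_of_sum_exp {ι : Type*} (s : Finset ι) (k : ι → ℂ) (g : ι → ℂ × ℂ → ℂ)
    {h : ℂ × ℂ → ℂ} (hg : ∀ i ∈ s, IsPolyOnLines (g i)) (hh : IsPolyOnLines h) {k₀ : ℂ}
    (hk₀ : k₀ ≠ 0) (H : ∀ z, ∑ i ∈ s, k i * exp (g i z) + k₀ * exp (h z) = 0) :
    ∃ i ∈ s, ∀ z, g i z - h z = g i 0 - h 0 := by
  by_contra! hcon
  obtain ⟨v, hv⟩ := exists_forall_ne s (fun i z => g i z - h z)
    (fun i hi => (hg i hi).sub hh) 0 hcon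
  choose! P hP using fun i hi => hg i hi 0 v
  obtain ⟨Q, hQ⟩ := hh 0 v
  refine hk₀ (Polynomial.C_eq_zero.mp (Polynomial.eq_zero_of_sum_mul_exp_add_eq_zero s
    (fun i => Polynomial.C (k i)) P _ Q (fun i hi h0 => hv i hi ?_) fun x => ?_))
  · have e := Polynomial.eq_C_of_derivative_eq_zero h0
    have e0 := congrArg (Polynomial.eval 0) e
    have e1 := congrArg (Polynomial.eval 1) e
    simp only [Polynomial.eval_sub, Polynomial.eval_C, ← hP i hi, ← hQ] at e0 e1
    simp only [zero_smul, one_smul, zero_add] at e0 e1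
    rw [e0, e1]
  · rw [← H (0 + x • v), hQ]
    congr 1
    · exact Finset.sum_congr rfl fun i hi => by rw [Polynomial.eval_C, hP i hi]
    · simp

/-- Subtracting a linear form with L(c) = m leaves a c-periodic function, hence one constant along
c; its restriction to a line transverse to c is Φ. -/
theorem exists_eq_phase (hp : IsPolyOnLines p) {c : ℂ × ℂ} (hc : c ≠ 0) {m : ℂ}
    (hm : ∀ z, p (z + c) = p z + m) :
    ∃ (α₁ α₂ A : ℂ) (Φ : Polynomial ℂ), _root_.linForm α₁ α₂ c = m ∧
      ∀ z, p z = phase c α₁ α₂ Φ A z := by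
  have hc' : c.1 ≠ 0 ∨ c.2 ≠ 0 := by
    by_contra! h
    exact hc (Prod.ext h.1 h.2)
  obtain ⟨α₁, α₂, hα⟩ : ∃ α₁ α₂, _root_.linForm α₁ α₂ c = m := by
    rcases hc' with h | h
    · exact ⟨m / c.1, 0, by simp [_root_.linForm, h]⟩
    · exact ⟨0, m / c.2, by simp [_root_.linForm, h]⟩
  -- The vector d is chosen so that t(d) = 1.
  obtain ⟨d, hd⟩ : ∃ d : ℂ × ℂ, ∀ z : ℂ × ℂ, ∃ s : ℂ,
      z = (c.2 * z.1 - c.1 * z.2) • d + s • c := by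
    rcases hc' with h | h
    · refine ⟨(0, -1 / c.1), fun z => ⟨z.1 / c.1, Prod.ext ?_ ?_⟩⟩ <;> simp <;> field_simp
      ring
    · refine ⟨(1 / c.2, 0), fun z => ⟨z.2 / c.2, Prod.ext ?_ ?_⟩⟩ <;> simp <;> field_simp
      ring
  have hg := hp.sub (IsPolyOnLines.linForm α₁ α₂)
  obtain ⟨Φ, hΦ⟩ := hg 0 d
  -- A = 0, since Φ already carries the constant term.
  refine ⟨α₁, α₂, 0, Φ, hα, fun z => ?_⟩
  have hper : ∀ z, p (z + c) - _root_.linForm α₁ α₂ (z + c) = p z - _root_.linForm α₁ α₂ z := by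
    intro z
    have : _root_.linForm α₁ α₂ (z + c) = _root_.linForm α₁ α₂ z + _root_.linForm α₁ α₂ c := by
      simp [_root_.linForm]; ring
    rw [this, hm, hα]; ring
  obtain ⟨s, hs⟩ := hd z
  have e1 := hg.apply_add_smul_of_periodic hper ((c.2 * z.1 - c.1 * z.2) • d) s
  simp only [zero_add] at hΦ
  rw [← hs, hΦ] at e1
  rw [phase, ← e1]; ring

end IsPolyOnLines

/-! ### From the system to relations between the phases -/

/-- `f` and `g` agree up to sign and an additive constant. -/
def EqUpToSignConst (f g : ℂ × ℂ → ℂ) : Prop :=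
  (∃ k, ∀ z, f z = g z + k) ∨ ∃ k, ∀ z, f z = -g z + k

namespace EqUpToSignConst

variable {f g h : ℂ × ℂ → ℂ}

theorem symm (H : EqUpToSignConst f g) : EqUpToSignConst g f := by
  rcases H with ⟨k, H⟩ | ⟨k, H⟩
  · exact .inl ⟨-k, fun z => by rw [H]; ring⟩
  · exact .inr ⟨k, fun z => by rw [H]; ring⟩

theorem trans (H : EqUpToSignConst f g) (H' : EqUpToSignConst g h) : EqUpToSignConst f h := by
  rcases H with ⟨k, H⟩ | ⟨k, H⟩ <;> rcases H' with ⟨l, H'⟩ | ⟨l, H'⟩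
  · exact .inl ⟨l + k, fun z => by rw [H, H']; ring⟩
  · exact .inr ⟨l + k, fun z => by rw [H, H']; ring⟩
  · exact .inr ⟨-l + k, fun z => by rw [H, H']; ring⟩
  · exact .inl ⟨-l + k, fun z => by rw [H, H']; ring⟩

/-- Borel's theorem matches exp(h) with another term; exp(-h) is ruled out because h is nonconstant.
-/
theorem of_exp_sum {α α' β β' γ γ' : ℂ} (hγ : γ ≠ 0) (hf : IsPolyOnLines f)
    (hg : IsPolyOnLines g) (hh : IsPolyOnLines h) (hne : ∃ z, h z ≠ h 0)
    (H : ∀ z, α * exp (f z) + α' * exp (-f z) + β * exp (g z) + β' * exp (-g z) +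
      γ * exp (h z) + γ' * exp (-h z) = 0) : EqUpToSignConst h f ∨ EqUpToSignConst h g := by
  obtain ⟨i, -, hi⟩ := IsPolyOnLines.exists_sub_eq_of_sum_exp (Finset.univ : Finset (Fin 5))
    ![α, α', β, β', γ'] ![f, fun z => -f z, g, fun z => -g z, fun z => -h z]
    (fun i _ => by fin_cases i; exacts [hf, hf.neg, hg, hg.neg, hh.neg]) hh hγ
    (fun z => by rw [← H z, Fin.sum_univ_five]; simp; ring)
  fin_cases i <;> simp [-Prod.forall] at hi
  · exact .inl (.inl ⟨h 0 - f 0, fun z => by linear_combination -hi z⟩)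
  · exact .inl (.inr ⟨f 0 + h 0, fun z => by linear_combination -hi z⟩)
  · exact .inr (.inl ⟨h 0 - g 0, fun z => by linear_combination -hi z⟩)
  · exact .inr (.inr ⟨g 0 + h 0, fun z => by linear_combination -hi z⟩)
  · obtain ⟨z, hz⟩ := hne
    exact absurd (by linear_combination -hi z / 2) hz

end EqUpToSignConst

theorem exists_isPolyOnLines_cos_sin {F G : ℂ × ℂ → ℂ} (hF : Differentiable ℂ F)
    (hG : Differentiable ℂ G) (hFg : ExpPolyGrowth F) (hGg : ExpPolyGrowth G)
    (H : ∀ z, F z ^ 2 + G z ^ 2 = 1) :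
    ∃ p, IsPolyOnLines p ∧ (∀ z, F z = cos (p z)) ∧ ∀ z, G z = sin (p z) := by
  have hmul : ∀ z, (F z + I * G z) * (F z - I * G z) = 1 := fun z => by
    linear_combination H z - G z ^ 2 * I_sq
  obtain ⟨P, hP, he⟩ := exists_isPolyOnLines_exp_eq (h := fun z => F z + I * G z) (by fun_prop)
    (fun z hz => by simpa [hz] using hmul z) (hFg.add (hGg.const_mul I))
  have he' : ∀ z, exp (-P z) = F z - I * G z := fun z => by
    rw [exp_neg, he]
    exact (eq_inv_of_mul_eq_one_right (hmul z)).symm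
  have hI : ∀ z, -I * P z * I = P z := fun z => by linear_combination -P z * I_sq
  refine ⟨fun z => -I * P z, hP.const_mul _, fun z => ?_, fun z => ?_⟩
  · rw [cos, neg_mul, hI, he, he']; ring
  · rw [sin, neg_mul, hI, he, he']; linear_combination G z * I_sq

theorem cos_eq_exp_I_mul (x : ℂ) : cos x = (exp (I * x) + exp (-(I * x))) / 2 := by
  rw [cos, mul_comm I, neg_mul]

theorem sin_eq_exp_I_mul (x : ℂ) : sin x = I * (exp (-(I * x)) - exp (I * x)) / 2 := by
  rw [sin, mul_comm I x, neg_mul]; ring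

theorem EqUpToSignConst.of_I_mul {f g : ℂ × ℂ → ℂ}
    (H : EqUpToSignConst (fun z => I * f z) (fun z => I * g z)) : EqUpToSignConst f g := by
  rcases H with ⟨k, H⟩ | ⟨k, H⟩
  · exact .inl ⟨-I * k, fun z => by linear_combination -I * H z + (f z - g z) * I_sq⟩
  · exact .inr ⟨-I * k, fun z => by linear_combination -I * H z + (f z + g z) * I_sq⟩

/-- Each of p, q, q(·+c) is related to one of the other two, and an equivalence relation on three
elements with no isolated one has a single class. -/
theorem shift_and_sign_of_cos_add_cos_eq_sin {p q : ℂ × ℂ → ℂ} (hp : IsPolyOnLines p)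
    (hq : IsPolyOnLines q) (hp' : ∃ z, p z ≠ p 0) (hq' : ∃ z, q z ≠ q 0) {c : ℂ × ℂ}
    {a b d : ℂ} (ha : a ≠ 0) (hb : b ≠ 0) (hd : d ≠ 0)
    (H : ∀ z, a * cos (q (z + c)) + b * cos (q z) = d * sin (p z)) :
    (∃ m, ∀ z, q (z + c) = q z + m) ∧ EqUpToSignConst p q := by
  have hr := hq.comp_add_const c
  have hr' : ∃ z, q (z + c) ≠ q (0 + c) := by
    by_contra! h
    obtain ⟨z, hz⟩ := hq'
    have h1 := h (z - c)
    have h2 := h (-c)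
    rw [sub_add_cancel] at h1
    rw [neg_add_cancel] at h2
    exact hz (h1.trans h2.symm)
  have hIne : ∀ {f : ℂ × ℂ → ℂ}, (∃ z, f z ≠ f 0) → ∃ z, I * f z ≠ I * f 0 :=
    fun ⟨z, hz⟩ => ⟨z, fun h => hz (mul_left_cancel₀ I_ne_zero h)⟩
  have hexp : ∀ z, a * exp (I * q (z + c)) + a * exp (-(I * q (z + c))) + b * exp (I * q z) +
      b * exp (-(I * q z)) + d * I * exp (I * p z) + -(d * I) * exp (-(I * p z)) = 0 := fun z => by
    have := H z
    rw [cos_eq_exp_I_mul, cos_eq_exp_I_mul, sin_eq_exp_I_mul] at this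
    linear_combination 2 * this
  have h1 : EqUpToSignConst p (fun z => q (z + c)) ∨ EqUpToSignConst p q :=
    (EqUpToSignConst.of_exp_sum (mul_ne_zero hd I_ne_zero) (hr.const_mul I) (hq.const_mul I)
      (hp.const_mul I) (hIne hp') hexp).imp .of_I_mul .of_I_mul
  have h2 : EqUpToSignConst q (fun z => q (z + c)) ∨ EqUpToSignConst q p :=
    (EqUpToSignConst.of_exp_sum (α := a) (α' := a) (β := d * I) (β' := -(d * I)) (γ' := b) hb
      (hr.const_mul I) (hp.const_mul I) (hq.const_mul I) (hIne hq')
      fun z => by linear_combination hexp z).imp .of_I_mul .of_I_mul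
  have h3 : EqUpToSignConst (fun z => q (z + c)) p ∨ EqUpToSignConst (fun z => q (z + c)) q :=
    (EqUpToSignConst.of_exp_sum (α := d * I) (α' := -(d * I)) (β := b) (β' := b) (γ' := a) ha
      (hp.const_mul I) (hq.const_mul I) (hr.const_mul I) (hIne hr')
      fun z => by linear_combination hexp z).imp .of_I_mul .of_I_mul
  have hrq : EqUpToSignConst (fun z => q (z + c)) q := by
    rcases h3 with h3 | h3
    · rcases h2 with h2 | h2
      · exact h2.symm
      · exact h3.trans h2.symm
    · exact h3
  have hpq : EqUpToSignConst p q := h1.elim (fun h => h.trans hrq) id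
  refine ⟨?_, hpq⟩
  rcases hrq with h | ⟨k, hk⟩
  · exact h
  · refine ⟨0, fun z => ?_⟩
    -- If q(z+c) = -q(z) + k, then 2c is a period, so q is constant along c and the shift constant
    -- is 0.
    have hper := hq.apply_add_smul_of_periodic (c := c + c)
      (fun z => by
        have e1 := hk (z + c)
        have e2 := hk z
        simp only at e1 e2
        rw [← add_assoc, e1, e2]; ring) z (1 / 2)
    rw [← hper, ← two_smul ℂ c, smul_smul]
    simp

/-! ### Comparison of coefficients -/

theorem coeffs_eq_zero_of_exp_I_mul {p : ℂ × ℂ → ℂ} (hp : Function.Surjective p) {α β : ℂ}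
    (H : ∀ z, α * exp (I * p z) + β * exp (-(I * p z)) = 0) : α = 0 ∧ β = 0 := by
  obtain ⟨x, hx⟩ := hp 0
  -- The values 1 and 2 of exp(ip) give an invertible system for α and β.
  obtain ⟨y, hy⟩ := hp (-I * Complex.log 2)
  have h1 := H x
  have h2 := H y
  have e : I * (-I * Complex.log 2) = Complex.log 2 := by
    linear_combination -Complex.log 2 * I_sq
  rw [hx] at h1
  rw [hy, e, exp_neg, exp_log two_ne_zero] at h2
  simp only [mul_zero, neg_zero, exp_zero, mul_one] at h1
  constructor
  · linear_combination (2 / 3) * h2 - h1 / 3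
  · linear_combination (4 / 3) * h1 - (2 / 3) * h2

theorem shift_coeffs_of_eq_add_const {p : ℂ × ℂ → ℂ} (hp : Function.Surjective p) {a b d m k : ℂ}
    (hd : d ≠ 0)
    (H₁ : ∀ z, a * cos (p z + m + k) + b * cos (p z + k) = d * sin (p z))
    (H₂ : ∀ z, a * cos (p z + m) + b * cos (p z) = d * sin (p z + k)) (ha : a ≠ 0) :
    a ^ 2 = d ^ 2 + b ^ 2 ∧ exp (2 * I * k) = 1 ∧
      exp (2 * I * m) = -((d - I * b * exp (-(I * k))) / (d + I * b * exp (I * k))) := by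
  have hl : exp (I * m) * exp (-(I * m)) = 1 := by rw [← exp_add]; simp
  have hk : exp (I * k) * exp (-(I * k)) = 1 := by rw [← exp_add]; simp
  have hl2 : exp (2 * I * m) = exp (I * m) ^ 2 := by rw [← exp_nat_mul]; congr 1; push_cast; ring
  have hk2 : exp (2 * I * k) = exp (I * k) ^ 2 := by rw [← exp_nat_mul]; congr 1; push_cast; ring
  rw [hl2, hk2]
  simp only [cos_eq_exp_I_mul, sin_eq_exp_I_mul, mul_add, neg_add, exp_add] at H₁ H₂
  generalize exp (I * m) = l at *
  generalize exp (-(I * m)) = l' at *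
  generalize exp (I * k) = w at *
  generalize exp (-(I * k)) = w' at *
  obtain ⟨e1, e2⟩ := coeffs_eq_zero_of_exp_I_mul hp (α := a * l * w + b * w + d * I)
    (β := a * l' * w' + b * w' - d * I) fun z => by linear_combination 2 * H₁ z
  obtain ⟨e3, e4⟩ := coeffs_eq_zero_of_exp_I_mul hp (α := a * l + b + d * I * w)
    (β := a * l' + b - d * I * w') fun z => by linear_combination 2 * H₂ z
  have hdI : d * I ≠ 0 := mul_ne_zero hd I_ne_zero
  -- Eliminating the shift terms between the two identities leaves d·i·(w² - 1) = 0.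
  have hw : w ^ 2 = 1 := mul_left_cancel₀ hdI (by linear_combination w * e3 - e1)
  have hww : w' = w := by linear_combination w * hk - w' * hw
  subst hww
  have hl0 : l' ≠ 0 := right_ne_zero_of_mul_eq_one hl
  have hden : d + I * b * w' ≠ 0 := fun h0 => by
    have : a * l' = 0 := by
      linear_combination e4 + I * w' * h0 - b * w' ^ 2 * I_sq + b * hw
    exact mul_ne_zero ha hl0 this
  refine ⟨?_, hw, ?_⟩
  · linear_combination (-a ^ 2) * hl + a * l * e4 + (- b + d * I * w') * e3 +
      (-d ^ 2 * w' ^ 2) * I_sq + d ^ 2 * hw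
  · rw [← neg_div, eq_div_iff hden]
    linear_combination I * w' * (l ^ 2 * e4 - e3) - I * w' * a * l * hl +
      d * w' ^ 2 * (l ^ 2 + 1) * I_sq - d * (l ^ 2 + 1) * hw

theorem shift_coeffs_of_eq_neg_add_const {q : ℂ × ℂ → ℂ} (hq : Function.Surjective q)
    {a b d m k : ℂ} (ha : a ≠ 0) (hd : d ≠ 0)
    (H₁ : ∀ z, a * cos (q z + m) + b * cos (q z) = d * sin (-q z + k))
    (H₂ : ∀ z, a * cos (-(q z + m) + k) + b * cos (-q z + k) = d * sin (q z)) :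
    (exp (I * m) = 1 ∧ ((exp (I * k) = I ∧ d = a + b) ∨ (exp (I * k) = -I ∧ d = -(a + b)))) ∨
      (exp (I * m) = -1 ∧
        ((exp (I * k) = I ∧ d = -(a - b)) ∨ (exp (I * k) = -I ∧ d = a - b))) := by
  have hl : exp (I * m) * exp (-(I * m)) = 1 := by rw [← exp_add]; simp
  have hk : exp (I * k) * exp (-(I * k)) = 1 := by rw [← exp_add]; simp
  simp only [cos_eq_exp_I_mul, sin_eq_exp_I_mul, mul_add, mul_neg, neg_add, neg_neg,
    exp_add] at H₁ H₂
  generalize exp (I * m) = l at *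
  generalize exp (-(I * m)) = l' at *
  generalize exp (I * k) = w at *
  generalize exp (-(I * k)) = w' at *
  obtain ⟨e1, e2⟩ := coeffs_eq_zero_of_exp_I_mul hq (α := a * l + b - d * I * w')
    (β := a * l' + b + d * I * w) fun z => by linear_combination 2 * H₁ z
  obtain ⟨e3, e4⟩ := coeffs_eq_zero_of_exp_I_mul hq (α := a * l * w' + b * w' + d * I)
    (β := a * l' * w + b * w - d * I) fun z => by linear_combination 2 * H₂ z
  have hdI : d * I ≠ 0 := mul_ne_zero hd I_ne_zero
  -- Here the same elimination leaves w² = -1; then w' = -w, and the two coefficients of the first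
  -- identity force l = l', so l² = 1.
  have hw : (w - I) * (w + I) = 0 :=
    mul_left_cancel₀ hdI (by linear_combination w * e2 - e4 - d * I * I_sq)
  have hww : w' = -w := by
    linear_combination -w * hk + w' * hw + w' * I_sq
  subst hww
  have hll : l' = l := mul_left_cancel₀ ha (by linear_combination e2 - e1)
  subst hll
  have hl2 : (l' - 1) * (l' + 1) = 0 := by linear_combination hl
  rcases mul_eq_zero.mp hw with h | h <;> rcases mul_eq_zero.mp hl2 with h' | h'
  · exact .inl ⟨by linear_combination h', .inl ⟨by linear_combination h,
      by linear_combination a * h' - e1 + d * I * h + d * I_sq⟩⟩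
  · exact .inr ⟨by linear_combination h', .inl ⟨by linear_combination h,
      by linear_combination a * h' - e1 + d * I * h + d * I_sq⟩⟩
  · exact .inl ⟨by linear_combination h', .inr ⟨by linear_combination h,
      by linear_combination -a * h' + e1 - d * I * h + d * I_sq⟩⟩
  · exact .inr ⟨by linear_combination h', .inr ⟨by linear_combination h,
      by linear_combination -a * h' + e1 - d * I * h + d * I_sq⟩⟩

/-! ### The main theorem -/

theorem IsTranscendentalEntire.exists_ne {f : ℂ × ℂ → ℂ} (hf : IsTranscendentalEntire f) :
    ∃ z, f z ≠ f 0 := by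
  by_contra! h
  exact hf.2 ⟨MvPolynomial.C (f 0), fun z => by rw [h z, MvPolynomial.eval_C]⟩

theorem theorem1p2 (a₁ a₂ a₃ : ℂ) (ha₁ : a₁ ≠ 0) (ha₂ : a₂ ≠ 0) (ha₃ : a₃ ≠ 0)
    (c : ℂ × ℂ) (hc : c ≠ 0) (f₁ f₂ : ℂ × ℂ → ℂ)
    (hf₁ : IsTranscendentalEntire f₁) (hf₂ : IsTranscendentalEntire f₂)
    (ho₁ : HasFiniteOrder f₁) (ho₂ : HasFiniteOrder f₂)
    (hsol : IsFermatSolution a₁ a₂ a₃ c f₁ f₂) :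
    ∃ (α₁ α₂ A k : ℂ) (Φ : Polynomial ℂ),
      -- Form I
      ((∀ z, f₁ z = 1 / a₁ * cos (phase c α₁ α₂ Φ A z)) ∧
        (∀ z, f₂ z = 1 / a₁ * cos (phase c α₁ α₂ Φ A z + k)) ∧
        a₂ ^ 2 = a₁ ^ 2 + a₃ ^ 2 ∧
        exp (2 * I * k) = 1 ∧
        exp (2 * I * linForm α₁ α₂ c) =
          -((a₁ - I * a₃ * exp (-(I * k))) / (a₁ + I * a₃ * exp (I * k)))) ∨
      -- Form II
      ((∀ z, f₁ z = 1 / a₁ * cos (-(phase c α₁ α₂ Φ A z) + k)) ∧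
        (∀ z, f₂ z = 1 / a₁ * cos (phase c α₁ α₂ Φ A z)) ∧
        ((exp (I * linForm α₁ α₂ c) = 1 ∧
            ((exp (I * k) = I ∧ a₁ = a₂ + a₃) ∨ (exp (I * k) = -I ∧ a₁ = -(a₂ + a₃)))) ∨
          (exp (I * linForm α₁ α₂ c) = -1 ∧
            ((exp (I * k) = I ∧ a₁ = -(a₂ - a₃)) ∨ (exp (I * k) = -I ∧ a₁ = a₂ - a₃))))) ∨
      -- Form III
      ((∀ z, f₁ z = 1 / a₁ * cos (-(phase c α₁ α₂ Φ A z) + linForm α₁ α₂ c + k)) ∧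
        (∀ z, f₂ z = 1 / a₁ * cos (phase c α₁ α₂ Φ A z)) ∧
        ((exp (I * linForm α₁ α₂ c) = 1 ∧
            ((exp (I * k) = I ∧ a₁ = a₂ + a₃) ∨ (exp (I * k) = -I ∧ a₁ = -(a₂ + a₃)))) ∨
          (exp (I * linForm α₁ α₂ c) = -1 ∧
            ((exp (I * k) = I ∧ a₁ = a₂ - a₃) ∨ (exp (I * k) = -I ∧ a₁ = -(a₂ - a₃)))))) := by
  obtain ⟨hd₁, hd₂⟩ := And.intro hf₁.1 hf₂.1
  have hg₁ := ho₁.expPolyGrowth hd₁.continuous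
  have hg₂ := ho₂.expPolyGrowth hd₂.continuous
  obtain ⟨p, hp, hpc, hps⟩ := exists_isPolyOnLines_cos_sin (F := fun z => a₁ * f₁ z)
    (G := fun z => a₂ * f₂ (z + c) + a₃ * f₂ z) (by fun_prop) (by fun_prop) (hg₁.const_mul _)
    (((hg₂.comp_add_const c).const_mul _).add (hg₂.const_mul _))
    fun z => by rw [mul_pow]; exact (hsol z).1
  obtain ⟨q, hq, hqc, hqs⟩ := exists_isPolyOnLines_cos_sin (F := fun z => a₁ * f₂ z)
    (G := fun z => a₂ * f₁ (z + c) + a₃ * f₁ z) (by fun_prop) (by fun_prop) (hg₂.const_mul _)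
    (((hg₁.comp_add_const c).const_mul _).add (hg₁.const_mul _))
    fun z => by rw [mul_pow]; exact (hsol z).2
  have hf₁p : ∀ z, f₁ z = 1 / a₁ * cos (p z) := fun z => by rw [← hpc]; field_simp
  have hf₂q : ∀ z, f₂ z = 1 / a₁ * cos (q z) := fun z => by rw [← hqc]; field_simp
  have hp' : ∃ z, p z ≠ p 0 := hf₁.exists_ne.imp fun z hz h => hz (by rw [hf₁p, h, ← hf₁p])
  have hq' : ∃ z, q z ≠ q 0 := hf₂.exists_ne.imp fun z hz h => hz (by rw [hf₂q, h, ← hf₂q])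
  have H₁ : ∀ z, a₂ * cos (q (z + c)) + a₃ * cos (q z) = a₁ * sin (p z) := fun z => by
    rw [← hqc, ← hqc, ← hps]; ring
  have H₂ : ∀ z, a₂ * cos (p (z + c)) + a₃ * cos (p z) = a₁ * sin (q z) := fun z => by
    rw [← hpc, ← hpc, ← hqs]; ring
  obtain ⟨⟨mq, hmq⟩, hpq⟩ :=
    shift_and_sign_of_cos_add_cos_eq_sin hp hq hp' hq' ha₂ ha₃ ha₁ H₁
  obtain ⟨⟨mp, hmp⟩, -⟩ :=
    shift_and_sign_of_cos_add_cos_eq_sin hq hp hq' hp' ha₂ ha₃ ha₁ H₂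
  -- Equal signs lead to form I with phase p, opposite signs to form II with phase q.
  rcases hpq.symm with ⟨k, hk⟩ | ⟨k, hk⟩
  · obtain ⟨α₁, α₂, A, Φ, hα, hph⟩ := hp.exists_eq_phase hc hmp
    obtain ⟨z₁, hz₁⟩ := hp'
    refine ⟨α₁, α₂, A, k, Φ, .inl ⟨fun z => by rw [hf₁p, hph], fun z => by rw [hf₂q, hk, hph], ?_⟩⟩
    rw [hα]
    refine shift_coeffs_of_eq_add_const (hp.surjective_of_ne hz₁) ha₁ (fun z => ?_)
      (fun z => ?_) ha₂
    · rw [← hmp, ← hk, ← hk, H₁]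
    · rw [← hmp, ← hk, H₂]
  · obtain ⟨α₁, α₂, A, Φ, hα, hph⟩ := hq.exists_eq_phase hc hmq
    obtain ⟨z₁, hz₁⟩ := hq'
    have hk' : ∀ z, p z = -q z + k := fun z => by rw [hk]; ring
    refine ⟨α₁, α₂, A, k, Φ, .inr (.inl ⟨fun z => by rw [hf₁p, hk', hph],
      fun z => by rw [hf₂q, hph], ?_⟩)⟩
    rw [hα]
    refine shift_coeffs_of_eq_neg_add_const (hq.surjective_of_ne hz₁) ha₂ ha₁ (fun z => ?_)
      (fun z => ?_)
    · rw [← hmq, ← hk', H₁]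
    · rw [← hmq, ← hk', ← hk', H₂]
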